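/- Let $d \ge 0$ and $n \ge 1$. A state $\omega$ is drawn from the standard Gaussian distribution $\mu = \mathcal N(0, I_d)$ on $\mathbb R^d$. A buyer has a private type $i \in \{1,\dots,n\}$, which has probability $f_i > 0$, $\sum_i f_i = 1$. Type $i$ has a preference vector $\theta_i \in \mathbb R^d$, and the utility of type $i$ from action $a \in \mathbb R$ in state $\omega$ is $u^i(\omega,a) = -(\theta_i^\top\omega - a)^2$. An experiment $E = (S,\pi)$ consists of a measurable space $S$ of signals and a Markov kernel $\pi(\cdot\mid\omega)$ from $\mathbb R^d$ to $S$; its value to type $i$ is $V(E,i) = \mathbb E_{s}\big[\max_{a \in \mathbb R} \mathbb E[u^i(\omega,a) \mid s]\big]$, where the signal $s$ is drawn from $\pi(\cdot \mid \omega)$ with $\omega \sim \mu$. Without information, type $i$ has utility $u^i = \max_{a \in \mathbb R} \mathbb E_{\omega\sim\mu}[u^i(\omega,a)]$. The seller, knowing $\mu$, the $\theta_i$ and the $f_i$ but not the type of the buyer, posts a menu, that is, a family of experiments $E$ with prices $t(E) \ge 0$. Each type then makes a choice that is optimal for it among buying an experiment $E$ of the menu, with net utility $V(E,i) - t(E)$,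 and buying nothing, with utility $u^i$ (ties may be broken in favor of the seller). The revenue of the menu is the expected payment. The full surplus, that is, the maximal revenue if the seller knew the type of the buyer and could make each type $i$ an individual offer $(E^i,t^i)$ with $t^i \ge 0$ and $V(E^i,i) - t^i \ge u^i$, is $\sum_{i=1}^n f_i\|\theta_i\|^2$. There is a menu with revenue $\sum_{i=1}^n f_i \|\theta_i\|^2$ if and only if $|\theta_i^\top\theta_j| \le \|\theta_i\|^2$ for all $i,j \in \{1,\dots,n\}$. The same equivalence holds for direct menus, that is, menus $(E^i,t^i)_{1 \le i \le n}$ with $t^i \ge 0$, with $V(E^i,i) - t^i \ge u^i$ for all $i$ and $V(E^i,i) - t^i \ge V(E^j,i) - t^j$ for all $i,j$, whose revenue is $\sum_{i=1}^n f_i t^i$. -/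

import Mathlib

open MeasureTheory ProbabilityTheory
open scoped NNReal

noncomputable section

namespace InfoMarket

/-- A statistical experiment on the state space `Ω`: a measurable space `S` of signals and a
signaling kernel `π` giving, for each state, a probability distribution on `S`. -/
structure Experiment (Ω : Type*) [MeasurableSpace Ω] where
  S : Type
  [measurableSpaceS : MeasurableSpace S]
  π : Kernel Ω S
  [isMarkovKernel : IsMarkovKernel π]

attribute [instance] Experiment.measurableSpaceS Experiment.isMarkovKernel

/-- A menu with options indexed by `ι`: each option is an experiment with a nonnegative price. -/
structure Menu (Ω : Type*) [MeasurableSpace Ω] (ι : Type*) where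
  experiment : ι → Experiment Ω
  price : ι → ℝ≥0

section General

variable {Ω A : Type*} [MeasurableSpace Ω] (μ : Measure Ω) (u : Ω → A → ℝ)

/-- The expected utility of a buyer with utility `u` who acts optimally under the belief `μ`. -/
def bestUtility : ℝ := ⨆ a : A, ∫ ω, u ω a ∂μ

/-- The value of the experiment `E` to a buyer with utility `u` and prior `μ`: the buyer observes
a signal `s`, distributed according to the marginal `E.π ∘ₘ μ`, and acts optimally under the
posterior belief `posterior E.π μ s`; the value is the expectation of the resulting utility. -/
def value [StandardBorelSpace Ω] [Nonempty Ω] [IsFiniteMeasure μ] (E : Experiment Ω) : ℝ :=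
  ∫ s, bestUtility (posterior E.π μ s) u ∂(E.π ∘ₘ μ)

/-- What a buyer pays: `none` stands for buying nothing. -/
def Menu.payment {ι : Type*} (M : Menu Ω ι) : Option ι → ℝ
  | none => 0
  | some k => M.price k

/-- The expected utility, net of payment, of a buyer with utility `u` and prior `μ`. -/
def Menu.netUtility [StandardBorelSpace Ω] [Nonempty Ω] [IsFiniteMeasure μ] {ι : Type*}
    (M : Menu Ω ι) : Option ι → ℝ
  | none => bestUtility μ u
  | some k => value μ u (M.experiment k) - M.price k

end General

section Revenue

variable {Ω A : Type*} [MeasurableSpace Ω] [StandardBorelSpace Ω] [Nonempty Ω]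
  (μ : Measure Ω) [IsFiniteMeasure μ] {n : ℕ} (u : Fin n → Ω → A → ℝ)

/-- Individual rationality of a menu whose option `i` is intended for type `i`. -/
def Menu.IsIR (M : Menu Ω (Fin n)) : Prop :=
  ∀ i, bestUtility μ (u i) ≤ value μ (u i) (M.experiment i) - M.price i

/-- Incentive compatibility of a menu whose option `i` is intended for type `i`. -/
def Menu.IsIC (M : Menu Ω (Fin n)) : Prop :=
  ∀ i j, value μ (u i) (M.experiment j) - M.price j ≤ value μ (u i) (M.experiment i) - M.price i

/-- The expected revenues when the seller knows the type `i` of the buyer and makes an individually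
rational offer to each type. Type `i` has probability `f i` and utility `u i`. -/
def fullInfoRevenues (f : Fin n → ℝ) : Set ℝ :=
  {r | ∃ M : Menu Ω (Fin n), M.IsIR μ u ∧ r = ∑ i, f i * M.price i}

/-- The expected revenues from posting one menu, with an arbitrary set of options, to a buyer whose
type is private, when each type `i` makes a choice `c i` that is optimal for it among all options
and buying nothing. -/
def menuRevenues (f : Fin n → ℝ) : Set ℝ :=
  {r | ∃ (ι : Type) (M : Menu Ω ι) (c : Fin n → Option ι),
    (∀ i o, M.netUtility μ (u i) o ≤ M.netUtility μ (u i) (c i)) ∧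
      r = ∑ i, f i * M.payment (c i)}

/-- The expected revenues from direct menus: incentive compatible and individually rational menus
with one option for each type. -/
def directMenuRevenues (f : Fin n → ℝ) : Set ℝ :=
  {r | ∃ M : Menu Ω (Fin n), M.IsIC μ u ∧ M.IsIR μ u ∧ r = ∑ i, f i * M.price i}

end Revenue

/-- The utility of a buyer estimating the projection of the state on `θ`, with quadratic loss. -/
def quadUtility {d : ℕ} (θ : EuclideanSpace ℝ (Fin d)) (ω : EuclideanSpace ℝ (Fin d)) (a : ℝ) : ℝ :=
  -(inner ℝ θ ω - a) ^ 2

end InfoMarket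

end

/-! Under quadratic loss an experiment is worth minus the expected posterior variance of θᵢᵀω: at
most 0, against -‖θᵢ‖² without information. So no type pays more than ‖θᵢ‖², and full extraction
forces each type to pay exactly that, every buyer to learn θᵢᵀω exactly, and no type to gain from
another's option.

Write θⱼ = cθᵢ + η with η ⊥ θᵢ. An experiment revealing θᵢᵀω leaves type j an expected variance of
at most ‖η‖² (`le_value_quadUtility_of_value_eq_zero`), with equality if it reveals nothing else
(`value_revealInner_le`). Since ‖θⱼ‖² = c²‖θᵢ‖² + ‖η‖², the price ‖θᵢ‖² can deter type j only if
c²‖θᵢ‖² ≤ ‖θᵢ‖², that is |θᵢᵀθⱼ| ≤ ‖θᵢ‖²; selling θᵢᵀω alone makes this sufficient. -/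

namespace InfoMarket

/-! ### Value of experiments under quadratic loss, for a general prior -/

section QuadraticLoss

variable {Ω : Type*} [MeasurableSpace Ω]

lemma integrable_sub_const_sq {ν : Measure Ω} [IsFiniteMeasure ν] {X : Ω → ℝ}
    (hX : MemLp X 2 ν) (a : ℝ) : Integrable (fun ω => (X ω - a) ^ 2) ν :=
  (hX.sub (memLp_const a)).integrable_sq

lemma variance_le_integral_sub_const_sq {ν : Measure Ω} [IsProbabilityMeasure ν] {X : Ω → ℝ}
    (hX : MemLp X 2 ν) (a : ℝ) : Var[X; ν] ≤ ∫ ω, (X ω - a) ^ 2 ∂ν := by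
  rw [← variance_sub_const hX.aestronglyMeasurable a]
  exact variance_le_expectation_sq (hX.aestronglyMeasurable.sub aestronglyMeasurable_const)

/-- No integrability is needed: the default integral 0 also satisfies the bound. -/
lemma bestUtility_quadratic_le {ν : Measure Ω} {X : Ω → ℝ} :
    bestUtility ν (fun ω a => -(X ω - a) ^ 2) ≤ 0 :=
  ciSup_le fun _ => integral_nonpos fun _ => neg_nonpos.2 (sq_nonneg _)

/-- The optimal action is the mean. -/
lemma bestUtility_quadratic {ν : Measure Ω} [IsProbabilityMeasure ν] {X : Ω → ℝ}
    (hX : MemLp X 2 ν) :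
    bestUtility ν (fun ω a => -(X ω - a) ^ 2) = -Var[X; ν] := by
  have hle (a : ℝ) : ∫ ω, -(X ω - a) ^ 2 ∂ν ≤ -Var[X; ν] := by
    rw [integral_neg]
    exact neg_le_neg (variance_le_integral_sub_const_sq hX a)
  refine le_antisymm (ciSup_le hle) ?_
  refine le_ciSup_of_le ⟨_, Set.forall_mem_range.2 hle⟩ (ν[X]) ?_
  rw [integral_neg, variance_eq_integral hX.aestronglyMeasurable.aemeasurable]

variable [StandardBorelSpace Ω] [Nonempty Ω] {μ : Measure Ω} [IsProbabilityMeasure μ]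

lemma value_quadratic_le (E : Experiment Ω) (X : Ω → ℝ) :
    value μ (fun ω a => -(X ω - a) ^ 2) E ≤ 0 :=
  integral_nonpos fun _ => bestUtility_quadratic_le

lemma integral_integral_posterior {S : Type*} [MeasurableSpace S] (κ : Kernel Ω S)
    [IsMarkovKernel κ] {g : Ω → ℝ} (hg : Integrable g μ) :
    ∫ s, ∫ ω, g ω ∂(posterior κ μ s) ∂(κ ∘ₘ μ) = ∫ ω, g ω ∂μ := by
  have hg' : Integrable g (posterior κ μ ∘ₘ (κ ∘ₘ μ)) := by rwa [posterior_comp_self]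
  rw [← Measure.integral_compProd ((Measure.integrable_compProd_snd_iff hg'.1).2 hg')]
  conv_rhs => rw [← posterior_comp_self (κ := κ) (μ := μ), ← Measure.snd_compProd]
  exact (integral_map measurable_snd.aemeasurable (by
    rw [← Measure.snd, Measure.snd_compProd]; exact hg'.1)).symm

lemma integrable_integral_sq_posterior {S : Type*} [MeasurableSpace S] (κ : Kernel Ω S)
    [IsMarkovKernel κ] {X : Ω → ℝ} (hX : MemLp X 2 μ) :
    Integrable (fun s => ∫ ω, X ω ^ 2 ∂(posterior κ μ s)) (κ ∘ₘ μ) := by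
  have hg : Integrable (fun ω => X ω ^ 2) (posterior κ μ ∘ₘ (κ ∘ₘ μ)) := by
    rw [posterior_comp_self]
    exact hX.integrable_sq
  simpa using Measure.integrable_integral_norm_of_integrable_comp hg

lemma ae_memLp_posterior {S : Type*} [MeasurableSpace S] (κ : Kernel Ω S)
    [IsMarkovKernel κ] {X : Ω → ℝ} (hXm : Measurable X) (hX : MemLp X 2 μ) :
    ∀ᵐ s ∂(κ ∘ₘ μ), MemLp X 2 (posterior κ μ s) := by
  have hg : Integrable (fun ω => X ω ^ 2) (posterior κ μ ∘ₘ (κ ∘ₘ μ)) := by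
    rw [posterior_comp_self]
    exact hX.integrable_sq
  filter_upwards [Measure.ae_integrable_of_integrable_comp hg] with s hs
  exact (memLp_two_iff_integrable_sq hXm.aestronglyMeasurable).2 hs

lemma stronglyMeasurable_posterior_mean {S : Type*} [MeasurableSpace S] (κ : Kernel Ω S)
    [IsMarkovKernel κ] {X : Ω → ℝ} (hXm : Measurable X) :
    StronglyMeasurable fun s => ∫ ω, X ω ∂(posterior κ μ s) :=
  hXm.stronglyMeasurable.integral_kernel

/-- The posterior variance is dominated by the posterior second moment, which averages to the prior
one. -/
lemma integrable_posterior_variance {S : Type*} [MeasurableSpace S] (κ : Kernel Ω S)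
    [IsMarkovKernel κ] {X : Ω → ℝ} (hXm : Measurable X) (hX : MemLp X 2 μ) :
    Integrable (fun s => Var[X; posterior κ μ s]) (κ ∘ₘ μ) := by
  have hsq := integrable_integral_sq_posterior (μ := μ) κ hX
  refine hsq.mono' ?_ ?_
  · refine AEStronglyMeasurable.congr (hsq.aestronglyMeasurable.sub
      ((stronglyMeasurable_posterior_mean (μ := μ) κ hXm).pow 2).aestronglyMeasurable) ?_
    filter_upwards [ae_memLp_posterior κ hXm hX] with s hs
    rw [variance_eq_sub hs]
    rfl
  · refine ae_of_all _ fun s => ?_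
    rw [Real.norm_of_nonneg (variance_nonneg _ _)]
    exact variance_le_expectation_sq hXm.aestronglyMeasurable

/-- The value of an experiment under quadratic loss is minus the expected posterior variance. -/
lemma value_quadratic (E : Experiment Ω) {X : Ω → ℝ} (hXm : Measurable X) (hX : MemLp X 2 μ) :
    value μ (fun ω a => -(X ω - a) ^ 2) E = -∫ s, Var[X; posterior E.π μ s] ∂(E.π ∘ₘ μ) := by
  rw [value, ← integral_neg]
  refine integral_congr_ae ?_
  filter_upwards [ae_memLp_posterior E.π hXm hX] with s hs using bestUtility_quadratic hs

/-- If an experiment reveals `X`, then the residual uncertainty about `c * X + Z` is at most the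
second moment of `Z`. -/
lemma le_value_quadratic_of_value_eq_zero (E : Experiment Ω) {X Z : Ω → ℝ} (hXm : Measurable X)
    (hX : MemLp X 2 μ) (hZm : Measurable Z) (hZ : MemLp Z 2 μ)
    (hE : value μ (fun ω a => -(X ω - a) ^ 2) E = 0) (c : ℝ) :
    -∫ ω, Z ω ^ 2 ∂μ ≤ value μ (fun ω a => -(c * X ω + Z ω - a) ^ 2) E := by
  have hYm : Measurable fun ω => c * X ω + Z ω := (hXm.const_mul c).add hZm
  have hY : MemLp (fun ω => c * X ω + Z ω) 2 μ := (hX.const_mul c).add hZ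
  rw [value_quadratic E hXm hX, neg_eq_zero,
    integral_eq_zero_iff_of_nonneg (fun s => variance_nonneg _ _)
      (integrable_posterior_variance E.π hXm hX)] at hE
  rw [value_quadratic E hYm hY, neg_le_neg_iff,
    ← integral_integral_posterior E.π hZ.integrable_sq]
  refine integral_mono_ae (integrable_posterior_variance E.π hYm hY)
    (integrable_integral_sq_posterior E.π hZ) ?_
  filter_upwards [hE, ae_memLp_posterior E.π hXm hX, ae_memLp_posterior E.π hZm hZ] with s hs hXs hZs
  -- Given the signal, X is almost surely its posterior mean, so the action c times that mean leaves
  -- only the error Z.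
  have hconst := ae_eq_integral_of_variance_eq_zero hXs hs
  refine (variance_le_integral_sub_const_sq ((hXs.const_mul c).add hZs)
    (c * (posterior E.π μ s)[X])).trans_eq (integral_congr_ae ?_)
  filter_upwards [hconst] with ω hω
  simp only [Pi.add_apply, hω]
  ring

/-- The experiment that reveals the value of a statistic `X`. -/
noncomputable def Experiment.reveal (X : Ω → ℝ) (hXm : Measurable X) : Experiment Ω where
  S := ℝ
  π := Kernel.deterministic X hXm

/-- The joint law of signal and state stands in for an explicit conditional distribution given X. -/
lemma compProd_posterior_deterministic {X : Ω → ℝ} (hXm : Measurable X) :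
    (Kernel.deterministic X hXm ∘ₘ μ) ⊗ₘ posterior (Kernel.deterministic X hXm) μ =
      μ.map (fun ω => (X ω, ω)) := by
  rw [compProd_posterior_eq_map_swap, Measure.compProd_deterministic,
    Measure.map_map measurable_swap (by fun_prop)]
  rfl

lemma value_reveal {X Y : Ω → ℝ} (hXm : Measurable X) (hYm : Measurable Y) (hY : MemLp Y 2 μ) :
    value μ (fun ω a => -(Y ω - a) ^ 2) (.reveal X hXm) =
      -∫ s, Var[Y; posterior (Kernel.deterministic X hXm) μ s]
        ∂(Kernel.deterministic X hXm ∘ₘ μ) :=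
  value_quadratic (.reveal X hXm) hYm hY

lemma value_reveal_self {X : Ω → ℝ} (hXm : Measurable X) (hX : MemLp X 2 μ) :
    value μ (fun ω a => -(X ω - a) ^ 2) (.reveal X hXm) = 0 := by
  rw [value_reveal hXm hXm hX, neg_eq_zero]
  refine integral_eq_zero_of_ae ?_
  have hset : MeasurableSet {p : ℝ × Ω | X p.2 = p.1} :=
    measurableSet_eq_fun (hXm.comp measurable_snd) measurable_fst
  have h : ∀ᵐ p ∂((Kernel.deterministic X hXm ∘ₘ μ) ⊗ₘ
      posterior (Kernel.deterministic X hXm) μ), X p.2 = p.1 := by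
    rw [compProd_posterior_deterministic, ae_map_iff (by fun_prop) hset]
    exact ae_of_all _ fun _ => rfl
  filter_upwards [Measure.ae_ae_of_ae_compProd h] with s hs
  rw [variance_congr (Y := fun _ => s) hs, variance_eq_integral aemeasurable_const]
  simp

/-- With m the posterior mean, the value becomes one integral under the prior, on which a symmetry
of the prior can act. -/
lemma exists_value_reveal_eq {X Y : Ω → ℝ} (hXm : Measurable X) (hYm : Measurable Y)
    (hY : MemLp Y 2 μ) : ∃ m : ℝ → ℝ, Integrable (fun ω => (Y ω - m (X ω)) ^ 2) μ ∧
      value μ (fun ω a => -(Y ω - a) ^ 2) (.reveal X hXm) = -∫ ω, (Y ω - m (X ω)) ^ 2 ∂μ := by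
  let κ := Kernel.deterministic X hXm
  have hm := (stronglyMeasurable_posterior_mean (μ := μ) κ hYm).measurable
  let m : ℝ → ℝ := fun s => ∫ ω, Y ω ∂(posterior κ μ s)
  change Measurable m at hm
  have hvar (s : ℝ) : ∫ ω, (Y ω - m s) ^ 2 ∂(posterior κ μ s) = Var[Y; posterior κ μ s] :=
    (variance_eq_integral hYm.aemeasurable).symm
  have hFm : Measurable fun p : ℝ × Ω => (Y p.2 - m p.1) ^ 2 := by fun_prop
  have hF : Integrable (fun p : ℝ × Ω => (Y p.2 - m p.1) ^ 2)
      ((κ ∘ₘ μ) ⊗ₘ posterior κ μ) := by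
    rw [Measure.integrable_compProd_iff hFm.aestronglyMeasurable]
    constructor
    · filter_upwards [ae_memLp_posterior κ hYm hY] with s hs using integrable_sub_const_sq hs _
    · simp only [norm_pow, Real.norm_eq_abs, sq_abs]
      exact (integrable_posterior_variance κ hYm hY).congr (ae_of_all _ fun s => (hvar s).symm)
  have h := Measure.integral_compProd hF
  have hκ : (κ ∘ₘ μ) ⊗ₘ posterior κ μ = μ.map (fun ω => (X ω, ω)) :=
    compProd_posterior_deterministic hXm
  rw [hκ] at hF
  refine ⟨m, hF.comp_measurable (by fun_prop), ?_⟩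
  rw [hκ, integral_map (by fun_prop) hFm.aestronglyMeasurable] at h
  rw [value_reveal hXm hYm hY, h]
  exact congrArg _ (integral_congr_ae (ae_of_all _ fun s => (hvar s).symm))

/-- If the prior is invariant under a map `R` that preserves `X` and flips the sign of `Z`, then
revealing `X` gives no information about `Z`. -/
lemma value_reveal_le {X Z : Ω → ℝ} (hXm : Measurable X)
    (hX : MemLp X 2 μ) (hZm : Measurable Z) (hZ : MemLp Z 2 μ) {R : Ω → Ω}
    (hR : MeasurePreserving R μ μ) (hRX : ∀ ω, X (R ω) = X ω) (hRZ : ∀ ω, Z (R ω) = -Z ω)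
    (c : ℝ) :
    value μ (fun ω a => -(c * X ω + Z ω - a) ^ 2) (.reveal X hXm) ≤ -∫ ω, Z ω ^ 2 ∂μ := by
  obtain ⟨m, hint, hval⟩ := exists_value_reveal_eq (μ := μ) hXm
    ((hXm.const_mul c).add hZm) ((hX.const_mul c).add hZ)
  simp only [Pi.add_apply] at hint hval
  have hint' : Integrable (fun ω => (c * X (R ω) + Z (R ω) - m (X (R ω))) ^ 2) μ :=
    hR.integrable_comp_of_integrable hint
  have hflip : ∫ ω, (c * X (R ω) + Z (R ω) - m (X (R ω))) ^ 2 ∂μ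
      = ∫ ω, (c * X ω + Z ω - m (X ω)) ^ 2 ∂μ := by
    have h := integral_map (μ := μ) (φ := R) hR.measurable.aemeasurable
      (f := fun ω => (c * X ω + Z ω - m (X ω)) ^ 2) (by rw [hR.map_eq]; exact hint.1)
    rw [hR.map_eq] at h
    exact h.symm
  rw [hval, neg_le_neg_iff]
  -- With u = cX - m(X), which R fixes, (u + Z)² + (u - Z)² = 2u² + 2Z² ≥ 2Z².
  have hsum : ∫ ω, 2 * Z ω ^ 2 ∂μ ≤ ∫ ω, ((c * X ω + Z ω - m (X ω)) ^ 2
      + (c * X (R ω) + Z (R ω) - m (X (R ω))) ^ 2) ∂μ := by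
    refine integral_mono (hZ.integrable_sq.const_mul 2) (hint.add hint') fun ω => ?_
    simp only [hRX, hRZ]
    nlinarith [sq_nonneg (c * X ω - m (X ω))]
  rw [integral_const_mul, integral_add hint hint', hflip] at hsum
  linarith

end QuadraticLoss

/-! ### Gaussian prior and orthogonal decomposition of types -/

section Gaussian

variable {d : ℕ}

local notation "𝔼" d => EuclideanSpace ℝ (Fin d)

lemma measurable_inner_right (θ : 𝔼 d) : Measurable fun ω : 𝔼 d => inner ℝ θ ω := by fun_prop

lemma memLp_inner_stdGaussian (θ : 𝔼 d) :
    MemLp (fun ω : 𝔼 d => inner ℝ θ ω) 2 (stdGaussian (𝔼 d)) :=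
  IsGaussian.memLp_dual _ (innerSL ℝ θ) 2 (by simp)

lemma variance_inner_stdGaussian (θ : 𝔼 d) :
    Var[fun ω : 𝔼 d => inner ℝ θ ω; stdGaussian (𝔼 d)] = ‖θ‖ ^ 2 := by
  have h := variance_dual_stdGaussian (innerSL ℝ θ)
  rwa [innerSL_apply_norm] at h

lemma integral_inner_sq_stdGaussian (θ : 𝔼 d) :
    ∫ ω : 𝔼 d, inner ℝ θ ω ^ 2 ∂(stdGaussian (𝔼 d)) = ‖θ‖ ^ 2 := by
  rw [← variance_inner_stdGaussian θ, variance_of_integral_eq_zero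
    (measurable_inner_right θ).aemeasurable]
  exact integral_strongDual_stdGaussian (innerSL ℝ θ)

lemma bestUtility_quadUtility (θ : 𝔼 d) :
    bestUtility (stdGaussian (𝔼 d)) (quadUtility θ) = -‖θ‖ ^ 2 := by
  rw [← variance_inner_stdGaussian θ]
  exact bestUtility_quadratic (memLp_inner_stdGaussian θ)

lemma value_quadUtility_le (E : Experiment (𝔼 d)) (θ : 𝔼 d) :
    value (stdGaussian (𝔼 d)) (quadUtility θ) E ≤ 0 :=
  value_quadratic_le E _

lemma quadUtility_add_smul (θ η : 𝔼 d) (c : ℝ) :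
    quadUtility (c • θ + η) = fun ω a => -(c * inner ℝ θ ω + inner ℝ η ω - a) ^ 2 := by
  ext ω a
  simp [quadUtility, inner_add_left, real_inner_smul_left]

lemma exists_eq_smul_add_orthogonal (θ φ : 𝔼 d) :
    ∃ (c : ℝ) (η : 𝔼 d), φ = c • θ + η ∧ inner ℝ η θ = (0 : ℝ) := by
  obtain ⟨y, hy, z, hz, h⟩ := (ℝ ∙ θ).exists_add_mem_mem_orthogonal φ
  obtain ⟨c, rfl⟩ := Submodule.mem_span_singleton.1 hy
  exact ⟨c, z, h, by
    rw [real_inner_comm]; exact (Submodule.mem_orthogonal_singleton_iff_inner_right.1 hz)⟩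

/-- The experiment that reveals `θᵀω`. -/
noncomputable def revealInner (θ : 𝔼 d) : Experiment (𝔼 d) :=
  .reveal (fun ω => inner ℝ θ ω) (measurable_inner_right θ)

lemma value_revealInner_self (θ : 𝔼 d) :
    value (stdGaussian (𝔼 d)) (quadUtility θ) (revealInner θ) = 0 :=
  value_reveal_self (measurable_inner_right θ) (memLp_inner_stdGaussian θ)

lemma value_revealInner_le (θ η : 𝔼 d) (h : inner ℝ η θ = (0 : ℝ)) (c : ℝ) :
    value (stdGaussian (𝔼 d)) (quadUtility (c • θ + η)) (revealInner θ) ≤ -‖η‖ ^ 2 := by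
  rw [quadUtility_add_smul, ← integral_inner_sq_stdGaussian η]
  -- The reflection in the hyperplane orthogonal to η preserves the Gaussian, fixes θ and negates η;
  -- it replaces independence of θᵀω and ηᵀω.
  let R : (𝔼 d) ≃ₗᵢ[ℝ] (𝔼 d) := (ℝ ∙ η)ᗮ.reflection
  have hθ : R θ = θ := Submodule.reflection_mem_subspace_eq_self
    (Submodule.mem_orthogonal_singleton_iff_inner_right.2 h)
  have hη : R η = -η := Submodule.reflection_orthogonalComplement_singleton_eq_neg η
  refine value_reveal_le (R := R) (measurable_inner_right θ) (memLp_inner_stdGaussian θ)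
    (measurable_inner_right η) (memLp_inner_stdGaussian η)
    ⟨R.continuous.measurable, stdGaussian_map R⟩ (fun ω => ?_) (fun ω => ?_) c
  · rw [← R.inner_map_map θ ω, hθ]
  · rw [← R.inner_map_map η ω, hη, inner_neg_left, neg_neg]

lemma le_value_quadUtility_of_value_eq_zero (E : Experiment (𝔼 d)) (θ η : 𝔼 d) (c : ℝ)
    (hE : value (stdGaussian (𝔼 d)) (quadUtility θ) E = 0) :
    -‖η‖ ^ 2 ≤ value (stdGaussian (𝔼 d)) (quadUtility (c • θ + η)) E := by
  rw [quadUtility_add_smul, ← integral_inner_sq_stdGaussian η]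
  exact le_value_quadratic_of_value_eq_zero E (measurable_inner_right θ)
    (memLp_inner_stdGaussian θ) (measurable_inner_right η) (memLp_inner_stdGaussian η) hE c

lemma norm_sq_smul_add_of_orthogonal {θ η : 𝔼 d} (h : inner ℝ η θ = (0 : ℝ)) (c : ℝ) :
    ‖c • θ + η‖ ^ 2 = c ^ 2 * ‖θ‖ ^ 2 + ‖η‖ ^ 2 := by
  rw [norm_add_sq_real, real_inner_smul_left, real_inner_comm, h, norm_smul, mul_pow,
    Real.norm_eq_abs, sq_abs]
  ring

lemma inner_smul_add_of_orthogonal {θ η : 𝔼 d} (h : inner ℝ η θ = (0 : ℝ)) (c : ℝ) :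
    inner ℝ θ (c • θ + η) = c * ‖θ‖ ^ 2 := by
  rw [inner_add_right, real_inner_smul_right, real_inner_comm η θ, h, real_inner_self_eq_norm_sq,
    add_zero]

/-- If type `φ` does not gain from an experiment that fully informs type `θ`, sold at the surplus
`‖θ‖ ^ 2` of that type, then `|θᵀφ| ≤ ‖θ‖ ^ 2`. -/
lemma abs_inner_le_of_value_sub_le (E : Experiment (𝔼 d)) (θ φ : 𝔼 d)
    (hE : value (stdGaussian (𝔼 d)) (quadUtility θ) E = 0)
    (hφ : value (stdGaussian (𝔼 d)) (quadUtility φ) E - ‖θ‖ ^ 2 ≤ -‖φ‖ ^ 2) :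
    |inner ℝ θ φ| ≤ ‖θ‖ ^ 2 := by
  obtain ⟨c, η, rfl, h⟩ := exists_eq_smul_add_orthogonal θ φ
  have hle := le_value_quadUtility_of_value_eq_zero E θ η c hE
  rw [norm_sq_smul_add_of_orthogonal h] at hφ
  rw [inner_smul_add_of_orthogonal h]
  -- `hle` and `hφ` give c²‖θ‖² ≤ ‖θ‖²; multiplying by ‖θ‖² yields the squared claim, also for θ =
  -- 0.
  refine abs_le_of_sq_le_sq ?_ (by positivity)
  nlinarith [sq_nonneg ‖θ‖]

/-- If `|θᵀφ| ≤ ‖θ‖ ^ 2`, then type `φ` does not gain from learning `θᵀω` at price `‖θ‖ ^ 2`. -/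
lemma value_revealInner_sub_le (θ φ : 𝔼 d) (hθφ : |inner ℝ θ φ| ≤ ‖θ‖ ^ 2) :
    value (stdGaussian (𝔼 d)) (quadUtility φ) (revealInner θ) - ‖θ‖ ^ 2 ≤ -‖φ‖ ^ 2 := by
  obtain ⟨c, η, rfl, h⟩ := exists_eq_smul_add_orthogonal θ φ
  have hle := value_revealInner_le θ η h c
  rw [inner_smul_add_of_orthogonal h, abs_mul, abs_of_nonneg (sq_nonneg ‖θ‖)] at hθφ
  rw [norm_sq_smul_add_of_orthogonal h]
  have hc : c ^ 2 * ‖θ‖ ^ 2 ≤ ‖θ‖ ^ 2 := by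
    -- For θ = 0 the hypothesis does not bound c.
    rcases (norm_nonneg θ).eq_or_lt with h0 | h0
    · simp [← h0]
    · have : |c| ≤ 1 := le_of_mul_le_mul_right (by simpa using hθφ) (pow_pos h0 2)
      exact mul_le_of_le_one_left (by positivity) ((sq_le_one_iff_abs_le_one c).2 this)
  linarith

end Gaussian

/-! ### Extraction of the full surplus -/

section Surplus

variable {n d : ℕ} {f : Fin n → ℝ} {θ : Fin n → EuclideanSpace ℝ (Fin d)}

/-- Turns full expected revenue into full payment by every single type. -/
lemma eq_of_sum_mul_eq_sum_mul {p q : Fin n → ℝ} (hf : ∀ i, 0 < f i) (hpq : ∀ i, p i ≤ q i)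
    (h : ∑ i, f i * q i = ∑ i, f i * p i) (i : Fin n) : p i = q i :=
  mul_left_cancel₀ (hf i).ne' ((Finset.sum_eq_sum_iff_of_le
    fun i _ => mul_le_mul_of_nonneg_left (hpq i) (hf i).le).1 h.symm i (Finset.mem_univ i))

/-- The menu that offers to reveal `θ iᵀω` at the price `‖θ i‖ ^ 2`, for each type `i`. -/
noncomputable def surplusMenu (θ : Fin n → EuclideanSpace ℝ (Fin d)) :
    Menu (EuclideanSpace ℝ (Fin d)) (Fin n) where
  experiment i := revealInner (θ i)
  price i := ‖θ i‖₊ ^ 2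

lemma surplusMenu_price (i : Fin n) : ((surplusMenu θ).price i : ℝ) = ‖θ i‖ ^ 2 := by
  simp [surplusMenu]

lemma surplusMenu_value_sub_price (i : Fin n) :
    value (stdGaussian (EuclideanSpace ℝ (Fin d))) (quadUtility (θ i))
      ((surplusMenu θ).experiment i) - (surplusMenu θ).price i = -‖θ i‖ ^ 2 := by
  rw [surplusMenu_price, show (surplusMenu θ).experiment i = revealInner (θ i) from rfl,
    value_revealInner_self, zero_sub]

lemma surplusMenu_isIR : (surplusMenu θ).IsIR (stdGaussian (EuclideanSpace ℝ (Fin d)))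
    (fun i => quadUtility (θ i)) := fun i => by
  rw [bestUtility_quadUtility, surplusMenu_value_sub_price]

lemma surplusMenu_value_sub_price_le (hθ : ∀ i j, |inner ℝ (θ i) (θ j)| ≤ ‖θ i‖ ^ 2)
    (i j : Fin n) :
    value (stdGaussian (EuclideanSpace ℝ (Fin d))) (quadUtility (θ i))
      ((surplusMenu θ).experiment j) - (surplusMenu θ).price j ≤ -‖θ i‖ ^ 2 := by
  rw [surplusMenu_price]
  exact value_revealInner_sub_le _ _ (hθ j i)

lemma price_le_of_isIR {M : Menu (EuclideanSpace ℝ (Fin d)) (Fin n)}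
    (hM : M.IsIR (stdGaussian (EuclideanSpace ℝ (Fin d))) (fun i => quadUtility (θ i)))
    (i : Fin n) : (M.price i : ℝ) ≤ ‖θ i‖ ^ 2 := by
  have h := hM i
  rw [bestUtility_quadUtility] at h
  linarith [value_quadUtility_le (M.experiment i) (θ i)]

lemma isGreatest_fullInfoRevenues (hf : ∀ i, 0 < f i) :
    IsGreatest (fullInfoRevenues (stdGaussian (EuclideanSpace ℝ (Fin d)))
      (fun i => quadUtility (θ i)) f) (∑ i, f i * ‖θ i‖ ^ 2) := by
  constructor
  · exact ⟨surplusMenu θ, surplusMenu_isIR, by simp_rw [surplusMenu_price]⟩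
  · rintro _ ⟨M, hM, rfl⟩
    exact Finset.sum_le_sum fun i _ =>
      mul_le_mul_of_nonneg_left (price_le_of_isIR hM i) (hf i).le

lemma abs_inner_le_of_mem_menuRevenues (hf : ∀ i, 0 < f i)
    (h : ∑ i, f i * ‖θ i‖ ^ 2 ∈ menuRevenues (stdGaussian (EuclideanSpace ℝ (Fin d)))
      (fun i => quadUtility (θ i)) f) (i j : Fin n) :
    |inner ℝ (θ i) (θ j)| ≤ ‖θ i‖ ^ 2 := by
  obtain ⟨ι, M, c, hopt, hrev⟩ := h
  have hnone (i : Fin n) : -‖θ i‖ ^ 2 ≤ M.netUtility (stdGaussian (EuclideanSpace ℝ (Fin d)))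
      (quadUtility (θ i)) (c i) :=
    (bestUtility_quadUtility (θ i)).symm.trans_le (hopt i none)
  have hpay (i : Fin n) : M.payment (c i) ≤ ‖θ i‖ ^ 2 := by
    have h := hnone i
    rcases hc : c i with _ | k
    · exact sq_nonneg _
    · rw [hc] at h
      simp only [Menu.netUtility] at h
      simp only [Menu.payment]
      linarith [value_quadUtility_le (M.experiment k) (θ i)]
  have heq := eq_of_sum_mul_eq_sum_mul hf hpay hrev
  -- A type that buys nothing pays 0, so its surplus is 0 and θᵢ = 0.
  rcases hc : c i with _ | k
  · have h0 := heq i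
    rw [hc] at h0
    have : θ i = 0 := by simpa [Menu.payment] using h0.symm
    simp [this]
  · have hi := heq i
    have hui := hnone i
    rw [hc] at hi hui
    simp only [Menu.payment] at hi
    simp only [Menu.netUtility] at hui
    have hval : value (stdGaussian (EuclideanSpace ℝ (Fin d))) (quadUtility (θ i))
        (M.experiment k) = 0 :=
      le_antisymm (value_quadUtility_le _ _) (by linarith)
    refine abs_inner_le_of_value_sub_le (M.experiment k) (θ i) (θ j) hval ?_
    rw [← hi]
    refine (hopt j (some k)).trans ?_
    -- Type j also pays its whole surplus, so its own choice nets it no more than -‖θⱼ‖², and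
    -- deviating to option k does no better.
    have hj := heq j
    rcases hc' : c j with _ | l
    · exact (bestUtility_quadUtility (θ j)).le
    · rw [hc'] at hj
      simp only [Menu.payment] at hj
      simp only [Menu.netUtility]
      linarith [value_quadUtility_le (M.experiment l) (θ j)]

lemma directMenuRevenues_subset_menuRevenues :
    directMenuRevenues (stdGaussian (EuclideanSpace ℝ (Fin d))) (fun i => quadUtility (θ i)) f ⊆
      menuRevenues (stdGaussian (EuclideanSpace ℝ (Fin d))) (fun i => quadUtility (θ i)) f := by
  rintro _ ⟨M, hIC, hIR, rfl⟩
  refine ⟨Fin n, M, some, fun i o => ?_, rfl⟩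
  rcases o with _ | k
  · exact hIR i
  · exact hIC i k

lemma mem_directMenuRevenues (hθ : ∀ i j, |inner ℝ (θ i) (θ j)| ≤ ‖θ i‖ ^ 2) :
    ∑ i, f i * ‖θ i‖ ^ 2 ∈ directMenuRevenues (stdGaussian (EuclideanSpace ℝ (Fin d)))
      (fun i => quadUtility (θ i)) f := by
  refine ⟨surplusMenu θ, fun i j => ?_, surplusMenu_isIR, by simp_rw [surplusMenu_price]⟩
  rw [surplusMenu_value_sub_price i]
  exact surplusMenu_value_sub_price_le hθ i j

end Surplus

end InfoMarket

theorem theorem4 (n d : ℕ) (f : Fin n → ℝ) (hf : ∀ i, 0 < f i) (hf_sum : ∑ i, f i = 1)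
    (θ : Fin n → EuclideanSpace ℝ (Fin d)) :
    -- the full surplus, i.e. the maximal revenue when the buyer's type is known to the seller
    IsGreatest
      (InfoMarket.fullInfoRevenues (stdGaussian (EuclideanSpace ℝ (Fin d)))
        (fun i => InfoMarket.quadUtility (θ i)) f)
      (∑ i, f i * ‖θ i‖ ^ 2) ∧
    -- it is the revenue of some posted menu if and only if the types are well separated
    (∑ i, f i * ‖θ i‖ ^ 2 ∈
        InfoMarket.menuRevenues (stdGaussian (EuclideanSpace ℝ (Fin d)))
          (fun i => InfoMarket.quadUtility (θ i)) f ↔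
      ∀ i j, |inner ℝ (θ i) (θ j)| ≤ ‖θ i‖ ^ 2) ∧
    -- and the same holds for incentive compatible and individually rational direct menus
    (∑ i, f i * ‖θ i‖ ^ 2 ∈
        InfoMarket.directMenuRevenues (stdGaussian (EuclideanSpace ℝ (Fin d)))
          (fun i => InfoMarket.quadUtility (θ i)) f ↔
      ∀ i j, |inner ℝ (θ i) (θ j)| ≤ ‖θ i‖ ^ 2) := by
  refine ⟨InfoMarket.isGreatest_fullInfoRevenues hf,
    ⟨InfoMarket.abs_inner_le_of_mem_menuRevenues hf, fun hθ =>
      InfoMarket.directMenuRevenues_subset_menuRevenues (InfoMarket.mem_directMenuRevenues hθ)⟩,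
    ⟨fun h => InfoMarket.abs_inner_le_of_mem_menuRevenues hf
      (InfoMarket.directMenuRevenues_subset_menuRevenues h),
      InfoMarket.mem_directMenuRevenues⟩⟩
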